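/- Let $G$ be a finite simple graph that is factorizable, i.e. has a perfect matching. An edge of $G$ is allowed if some perfect matching of $G$ contains it. A factor-component of $G$ is an induced subgraph $G[V(C)]$, where $C$ is a connected component of the spanning subgraph of $G$ formed by the allowed edges; let $\mathcal{G}(G)$ be the set of factor-components. A graph is factor-critical if deleting any single vertex leaves a factorizable graph. For $G_1,G_2\in\mathcal{G}(G)$ write $G_1\preceq G_2$ if there is a set $X\subseteq V(G)$ such that every $H\in\mathcal{G}(G)$ satisfies $V(H)\subseteq X$ or $V(H)\cap X=\emptyset$, such that $V(G_1)\cup V(G_2)\subseteq X$, and such that the graph $G[X]/G_1$, obtained from $G[X]$ by contracting all edges of $G_1$, is factor-critical. For $G_0\in\mathcal{G}(G)$ and $u,v\in V(G_0)$ write $u\sim v$ if $u=v$ or $G-u-v$ is not factorizable; the generalized canonical partition $\mathcal{P}_G(G_0)$ is the family of equivalence classes of $\sim$ on $V(G_0)$. Theorem. Let $G$ be a finite factorizable graph, let $G_0\in\mathcal{G}(G)$, and let $U$ be the union of the vertex sets $V(H)$ over all $H\in\mathcal{G}(G)$ with $G_0\preceq H$ and $H\neq G_0$. Then for each connected component $K$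 of $G[U]$ there exists $T_K\in\mathcal{P}_G(G_0)$ such that $\Gamma(K)\cap V(G_0)\subseteq T_K$, where $\Gamma(K)$ is the set of vertices outside $V(K)$ that are adjacent to a vertex of $K$. -/

import Mathlib

namespace KotzigOrder

variable {V : Type*}

/-- A graph is factorizable if it has a perfect matching. -/
def IsFactorizable (G : SimpleGraph V) : Prop :=
  ∃ M : G.Subgraph, M.IsPerfectMatching

/-- The spanning subgraph of `G` whose edges are the allowed edges of `G`, that is, the edges
contained in some perfect matching of `G`. -/
def allowedGraph (G : SimpleGraph V) : SimpleGraph V where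
  Adj u v := ∃ M : G.Subgraph, M.IsPerfectMatching ∧ M.Adj u v
  symm := ⟨fun _ _ ⟨M, hM, h⟩ => ⟨M, hM, h.symm⟩⟩
  loopless := ⟨fun _ ⟨M, _, h⟩ => M.loopless.irrefl _ h⟩

/-- The set of factor-components of `G`: the subgraphs of `G` induced by the vertex sets of the
connected components of the graph of allowed edges. -/
def factorComponents (G : SimpleGraph V) : Set G.Subgraph :=
  {H | ∃ C : (allowedGraph G).ConnectedComponent, H = (⊤ : G.Subgraph).induce C.supp}

/-- A graph is factor-critical if deleting any single vertex leaves a factorizable graph. -/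
def IsFactorCritical (G : SimpleGraph V) : Prop :=
  ∀ v : V, IsFactorizable (G.induce {v}ᶜ)

/-- The graph `(V(G), E(G[S]))`. -/
def edgesWithin (G : SimpleGraph V) (S : Set V) : SimpleGraph V :=
  ((⊤ : G.Subgraph).induce S).spanningCoe

/-- The contraction `G / S`, obtained from `G` by contracting all edges of `G[S]`: its vertices are
the connected components of `(V(G), E(G[S]))`, and two distinct ones are adjacent if `G` has an edge
between them. -/
def contract (G : SimpleGraph V) (S : Set V) :
    SimpleGraph (edgesWithin G S).ConnectedComponent :=
  G.map (edgesWithin G S).connectedComponentMk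

/-- A set of vertices is separating if every factor-component is contained in it or disjoint
from it. -/
def IsSeparating (G : SimpleGraph V) (X : Set V) : Prop :=
  ∀ H ∈ factorComponents G, H.verts ⊆ X ∨ H.verts ∩ X = ∅

/-- `X` is a critical-inducing set for `G₁`: it is separating, it contains `V(G₁)`, and `G[X] / G₁`
is factor-critical. -/
def IsCriticalInducing (G : SimpleGraph V) (G₁ : G.Subgraph) (X : Set V) : Prop :=
  IsSeparating G X ∧ G₁.verts ⊆ X ∧
    IsFactorCritical (contract (G.induce X) {x : X | (x : V) ∈ G₁.verts})

/-- The order between factor-components: `G₁` is below `G₂` if some critical-inducing set for `G₁`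
contains `V(G₂)`. -/
def Yields (G : SimpleGraph V) (G₁ G₂ : G.Subgraph) : Prop :=
  ∃ X : Set V, IsCriticalInducing G G₁ X ∧ G₂.verts ⊆ X

/-- The strict upper bounds of `H` among the factor-components. -/
def strictUpper (G : SimpleGraph V) (H : G.Subgraph) : Set G.Subgraph :=
  {I | I ∈ factorComponents G ∧ Yields G H I ∧ I ≠ H}

/-- The set of all vertices of the strict upper bounds of `H`. -/
def strictUpperVerts (G : SimpleGraph V) (H : G.Subgraph) : Set V :=
  {v | ∃ I ∈ strictUpper G H, v ∈ I.verts}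

/-- `u ∼ v` if `u = v` or `G - u - v` is not factorizable. -/
def KotzigRel (G : SimpleGraph V) (u v : V) : Prop :=
  u = v ∨ ¬ IsFactorizable (G.induce {u, v}ᶜ)

/-- The generalized canonical partition of the factor-component `H`: the family of the classes
of `∼` on `V(H)`. -/
def canonicalPartition (G : SimpleGraph V) (H : G.Subgraph) : Set (Set V) :=
  {T | ∃ u ∈ H.verts, T = {v | v ∈ H.verts ∧ KotzigRel G u v}}

/-- The neighbours of a set `S` of vertices: the vertices outside `S` adjacent to a vertex
of `S`. -/
def neighbours (G : SimpleGraph V) (S : Set V) : Set V :=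
  {v | v ∉ S ∧ ∃ u ∈ S, G.Adj u v}

end KotzigOrder

/-! Let `Z = V(G₀)`, let `u`, `v` be distinct neighbours of `K` in `Z`, and suppose that `G - u - v`
has a perfect matching. Take a barrier `B` containing `u` with as many disjoint odd sets `𝒟` as
vertices, all neighbours of an odd set lying in it or in `B`. It can be chosen with factor-critical
odd sets (Tutte's theorem and maximality, `exists_isCriticalBarrier`) and with a surplus in Hall's
condition (minimality, `exists_isCriticalBarrier_surplus`). The surplus makes every edge between `B
∩ Z` and an odd set allowed (`IsCriticalBarrier.allowedGraph_adj`), so no vertex of `K` in an odd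
set has a neighbour in `B ∩ Z`.

The heart is `not_matchesOn_of_adj`. If `B` met `K` in `b`, a near-perfect matching of `G[X]/G₀`
missing `b`, with `X` critical-inducing, would have to match the odd traces belonging to `B ∩ K ∩ X`
injectively into `B ∩ K ∩ X` without `b`. So `K` avoids `B`, and by connectedness it lies in one odd
set or misses them all. A neighbour of `u` in `K` forces the latter. But `v` lies in an odd set, and
so its neighbours in `K` would too. -/

namespace KotzigOrder

/-! ### Perfect matchings as partner functions -/

variable {V : Type*}

/-- `f` sends every vertex of `S` to its partner in a perfect matching of `G[S]`. -/
def MatchesOn (G : SimpleGraph V) (f : V → V) (S : Set V) : Prop :=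
  ∀ v ∈ S, f v ∈ S ∧ G.Adj v (f v) ∧ f (f v) = v

theorem exists_matching_function {G : SimpleGraph V} {M : G.Subgraph}
    (hM : M.IsPerfectMatching) :
    ∃ f : V → V, MatchesOn G f Set.univ ∧ ∀ u v, M.Adj u v ↔ f u = v := by
  rw [SimpleGraph.Subgraph.isPerfectMatching_iff] at hM
  choose f hf hu using hM
  refine ⟨f, fun v _ => ⟨trivial, (hf v).adj_sub, (hu _ _ (hf v).symm).symm⟩, fun u v => ?_⟩
  exact ⟨fun h => (hu _ _ h).symm, fun h => h ▸ hf u⟩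

/-- The perfect matching encoded by a partner function. -/
def MatchesOn.toSubgraph {G : SimpleGraph V} {f : V → V} (h : MatchesOn G f Set.univ) :
    G.Subgraph where
  verts := Set.univ
  Adj u v := f u = v
  adj_sub := by
    rintro u v rfl
    exact (h u trivial).2.1
  edge_vert _ := trivial
  symm := ⟨by
    rintro u v rfl
    exact (h u trivial).2.2⟩

theorem MatchesOn.isPerfectMatching {G : SimpleGraph V} {f : V → V}
    (h : MatchesOn G f Set.univ) : h.toSubgraph.IsPerfectMatching := by
  rw [SimpleGraph.Subgraph.isPerfectMatching_iff]
  exact fun v => ⟨f v, rfl, fun _ hw => Eq.symm hw⟩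

theorem isFactorizable_iff {G : SimpleGraph V} :
    IsFactorizable G ↔ ∃ f, MatchesOn G f Set.univ :=
  ⟨fun ⟨_, hM⟩ => let ⟨f, hf, _⟩ := exists_matching_function hM; ⟨f, hf⟩,
    fun ⟨_, hf⟩ => ⟨_, hf.isPerfectMatching⟩⟩

theorem allowedGraph_adj_iff {G : SimpleGraph V} {u v : V} :
    (allowedGraph G).Adj u v ↔ ∃ f, MatchesOn G f Set.univ ∧ f u = v := by
  constructor
  · rintro ⟨M, hM, h⟩
    obtain ⟨f, hf, hMf⟩ := exists_matching_function hM
    exact ⟨f, hf, (hMf _ _).1 h⟩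
  · rintro ⟨f, hf, h⟩
    exact ⟨_, hf.isPerfectMatching, h⟩

theorem isFactorizable_induce_iff {G : SimpleGraph V} {S : Set V} :
    IsFactorizable (G.induce S) ↔ ∃ f, MatchesOn G f S := by
  classical
  rw [isFactorizable_iff]
  constructor
  · rintro ⟨f, hf⟩
    refine ⟨fun v => if h : v ∈ S then f ⟨v, h⟩ else v, fun v hv => ?_⟩
    have := hf ⟨v, hv⟩ trivial
    simp only [hv, dif_pos, Subtype.coe_prop, true_and]
    exact ⟨this.2.1, congrArg Subtype.val this.2.2⟩
  · rintro ⟨f, hf⟩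
    exact ⟨fun v => ⟨f v, (hf v v.2).1⟩,
      fun v _ => ⟨trivial, (hf v v.2).2.1, Subtype.ext (hf v v.2).2.2⟩⟩

/-- A union of disjoint matched sets is matched. -/
theorem exists_matchesOn_iUnion {G : SimpleGraph V} {ι : Type*} {S : ι → Set V}
    (hS : ∀ i, ∃ f, MatchesOn G f (S i))
    (hd : ∀ i j v, v ∈ S i → v ∈ S j → i = j) : ∃ f, MatchesOn G f (⋃ i, S i) := by
  classical
  choose f hf using hS
  have key : ∀ i, ∀ v ∈ S i,
      (if h : ∃ i, v ∈ S i then f h.choose v else v) = f i v := by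
    intro i v hv
    have h : ∃ i, v ∈ S i := ⟨i, hv⟩
    rw [dif_pos h, hd _ _ v h.choose_spec hv]
  refine ⟨fun v => if h : ∃ i, v ∈ S i then f h.choose v else v, fun v hv => ?_⟩
  obtain ⟨i, hi⟩ := Set.mem_iUnion.1 hv
  have hfi := hf i v hi
  beta_reduce
  rw [key i v hi, key i _ hfi.1]
  exact ⟨Set.mem_iUnion.2 ⟨i, hfi.1⟩, hfi.2⟩

theorem exists_matchesOn_union {G : SimpleGraph V} {S T : Set V}
    (hS : ∃ f, MatchesOn G f S) (hT : ∃ f, MatchesOn G f T) (hd : Disjoint S T) :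
    ∃ f, MatchesOn G f (S ∪ T) := by
  have := exists_matchesOn_iUnion (G := G) (S := fun b : Bool => cond b S T)
    (by rintro (_ | _) <;> assumption) (by
      have := Set.disjoint_left.1 hd
      rintro (_ | _) (_ | _) v hv hw <;> simp_all)
  rwa [← Set.union_eq_iUnion] at this

theorem exists_matchesOn_pair {G : SimpleGraph V} {u v : V} (h : G.Adj u v) :
    ∃ f, MatchesOn G f {u, v} := by
  classical
  refine ⟨Equiv.swap u v, ?_⟩
  rintro w (rfl | rfl)
  · simp [h]
  · simp [h.symm]

theorem allowedGraph_adj_of_matchesOn {G : SimpleGraph V} {u v : V} (h : G.Adj u v)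
    (hf : ∃ f, MatchesOn G f {u, v}ᶜ) : (allowedGraph G).Adj u v := by
  classical
  obtain ⟨f, hf⟩ := hf
  refine allowedGraph_adj_iff.2
    ⟨fun w => if w = u then v else if w = v then u else f w, fun w _ => ?_, by simp⟩
  have hne := h.ne
  by_cases hu : w = u
  · subst hu; simp [h, hne.symm]
  by_cases hv : w = v
  · subst hv; simp [h.symm, hu]
  have := hf w (by simp [hu, hv])
  have h1 : f w ≠ u := fun e => this.1 (by simp [e])
  have h2 : f w ≠ v := fun e => this.1 (by simp [e])
  simp [hu, hv, h1, h2, this]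

/-! ### Parity, Tutte's theorem and counting odd sets -/

theorem even_card_of_involution [DecidableEq V] {S : Finset V} {f : V → V}
    (h : ∀ v ∈ S, f v ∈ S ∧ f v ≠ v ∧ f (f v) = v) : Even S.card := by
  have : (∑ _v ∈ S, (1 : ZMod 2)) = 0 :=
    Finset.sum_involution (fun v _ => f v) (fun _ _ => by decide)
      (fun v hv _ => (h v hv).2.1) (fun v hv => (h v hv).1) (fun v hv => (h v hv).2.2)
  rw [Finset.sum_const, nsmul_one] at this
  exact (ZMod.natCast_eq_zero_iff_even).1 this

/-- Tutte's theorem gives an excess of one. As `|V|` is even, the number of odd components has the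
parity of `|R|`, so the excess is at least two. -/
theorem exists_oddComponents_of_not_isFactorizable [Finite V] {H : SimpleGraph V}
    (heven : Even (Nat.card V)) (h : ¬ IsFactorizable H) :
    ∃ (R : Set V) (𝒞 : Set (Set V)), R.ncard + 2 ≤ 𝒞.ncard ∧ ∀ C ∈ 𝒞, Odd C.ncard ∧
      (∀ x ∈ C, x ∉ R) ∧ (∀ x ∈ C, ∀ y, H.Adj x y → y ∈ C ∨ y ∈ R) ∧
      ∀ C' ∈ 𝒞, ∀ x ∈ C, x ∈ C' → C = C' := by
  obtain ⟨R, hR⟩ := not_forall_not.1 fun h1 => h (SimpleGraph.tutte.2 h1)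
  unfold SimpleGraph.IsTutteViolator at hR
  set H' := ((⊤ : H.Subgraph).deleteVerts R).coe with hH'
  have hpar := SimpleGraph.odd_ncard_oddComponents H'
  have hcard : Nat.card ((⊤ : H.Subgraph).deleteVerts R).verts + R.ncard = Nat.card V := by
    rw [Nat.card_coe_set_eq]
    simpa using Set.ncard_sdiff_add_ncard_of_subset (Set.subset_univ R)
  have hinj : Function.Injective
      (fun c : H'.ConnectedComponent => (Subtype.val '' c.supp : Set V)) := fun c c' hcc =>
    SimpleGraph.ConnectedComponent.supp_injective (Subtype.val_injective.image_injective hcc)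
  refine ⟨R, (fun c : H'.ConnectedComponent => (Subtype.val '' c.supp : Set V)) ''
    H'.oddComponents, ?_, ?_⟩
  · rw [Set.ncard_image_of_injective _ hinj]
    grind
  · rintro _ ⟨c, hc, rfl⟩
    refine ⟨?_, ?_, ?_, ?_⟩
    · rw [Set.ncard_image_of_injective _ Subtype.val_injective]
      exact hc
    · rintro _ ⟨x, -, rfl⟩
      exact x.2.2
    · rintro _ ⟨x, hx, rfl⟩ y hxy
      by_cases hy : y ∈ R
      · exact Or.inr hy
      · refine Or.inl ⟨⟨y, trivial, hy⟩, ?_, rfl⟩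
        refine SimpleGraph.ConnectedComponent.mem_supp_of_adj_mem_supp _ hx ?_
        have := x.2.2
        simp [hH', hxy, hy, this]
    · rintro _ ⟨c', hc', rfl⟩ _ ⟨x, hx, rfl⟩ ⟨y, hy, hxy⟩
      obtain rfl := Subtype.ext hxy
      have : c = c' := by
        rw [SimpleGraph.ConnectedComponent.mem_supp_iff] at hx hy
        exact hx.symm.trans hy
      rw [this]

theorem exists_oddFamily_of_not_matchesOn [Fintype V] [DecidableEq V] {G : SimpleGraph V}
    {S : Finset V} (heven : Even S.card) (h : ¬ ∃ f, MatchesOn G f S) :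
    ∃ (R : Finset V) (𝒞 : Finset (Finset V)), R ⊆ S ∧ R.card + 2 ≤ 𝒞.card ∧ ∀ C ∈ 𝒞,
      Odd C.card ∧ C ⊆ S ∧ (∀ x ∈ C, x ∉ R) ∧
      (∀ x ∈ C, ∀ y ∈ S, G.Adj x y → y ∈ C ∨ y ∈ R) ∧
      ∀ C' ∈ 𝒞, ∀ x ∈ C, x ∈ C' → C = C' := by
  classical
  rw [← isFactorizable_induce_iff] at h
  obtain ⟨R, 𝒞, hcard, h𝒞⟩ :=
    exists_oddComponents_of_not_isFactorizable (by simpa using heven) h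
  have hinj : Function.Injective
      (fun C : Set ((S : Set V) : Type _) => C.toFinset.map (Function.Embedding.subtype _)) := by
    intro C C' hC
    simpa using hC
  refine ⟨R.toFinset.map (Function.Embedding.subtype _), 𝒞.toFinset.image
    (fun C => C.toFinset.map (Function.Embedding.subtype _)), ?_, ?_, ?_⟩
  · intro x
    simp +contextual
  · rw [Finset.card_image_of_injective _ hinj, Finset.card_map]
    simpa [Set.ncard_eq_toFinset_card'] using hcard
  · intro C hC
    obtain ⟨C, hC, rfl⟩ := Finset.mem_image.1 hC
    obtain ⟨h1, h2, h3, h4⟩ := h𝒞 C (by simpa using hC)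
    refine ⟨?_, ?_, ?_, ?_, ?_⟩
    · simpa [Set.ncard_eq_toFinset_card'] using h1
    · intro x; simp +contextual
    · simp only [Finset.mem_map, Set.mem_toFinset, not_exists, not_and]
      rintro _ ⟨x, hx, rfl⟩ y hy hxy
      obtain rfl := Subtype.ext hxy
      exact h2 _ hx hy
    · simp only [Finset.mem_map, Set.mem_toFinset]
      rintro _ ⟨x, hx, rfl⟩ y hy hxy
      rcases h3 x hx ⟨y, hy⟩ hxy with h | h
      · exact Or.inl ⟨_, h, rfl⟩
      · exact Or.inr ⟨_, h, rfl⟩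
    · intro C' hC'
      obtain ⟨C', hC', rfl⟩ := Finset.mem_image.1 hC'
      simp only [Finset.mem_map, Set.mem_toFinset]
      rintro _ ⟨x, hx, rfl⟩ ⟨y, hy, hxy⟩
      obtain rfl := Subtype.ext hxy
      obtain rfl := h4 C' (by simpa using hC') _ hx hy
      rfl

/-- Disjoint odd sets from each of which an involution must leave into `A` are at most
as many as the elements of `A`. -/
theorem card_le_card_of_odd_sets [DecidableEq V] {ι : Type*} {I : Finset ι}
    {E : ι → Finset V} {A : Finset V} {f : V → V} (hodd : ∀ i ∈ I, Odd (E i).card)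
    (hdisj : ∀ i ∈ I, ∀ j ∈ I, ∀ x ∈ E i, x ∈ E j → i = j)
    (hf : ∀ i ∈ I, ∀ x ∈ E i, f x ≠ x ∧ f (f x) = x ∧ (f x ∈ E i ∨ f x ∈ A)) :
    I.card ≤ A.card := by
  have hex : ∀ i ∈ I, ∃ x ∈ E i, f x ∉ E i := by
    intro i hi
    by_contra! hcon
    exact Nat.not_even_iff_odd.2 (hodd i hi) (even_card_of_involution
      fun v hv => ⟨hcon v hv, (hf i hi v hv).1, (hf i hi v hv).2.1⟩)
  rcases I.eq_empty_or_nonempty with rfl | ⟨i₀, hi₀⟩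
  · simp
  have : Nonempty V := ⟨(hex i₀ hi₀).choose⟩
  choose! x hx hfx using hex
  refine Finset.card_le_card_of_injOn (fun i => f (x i))
    (fun i hi => ((hf i hi _ (hx i hi)).2.2).resolve_left (hfx i hi)) ?_
  intro i hi j hj hij
  have : x i = x j := by
    rw [← (hf i hi _ (hx i hi)).2.1, ← (hf j hj _ (hx j hj)).2.1]
    exact congrArg f hij
  exact hdisj i hi j hj _ (hx i hi) (this ▸ hx j hj)

/-! ### Odd barriers and their extremal choice -/

/-- A set `B` with at least `|B|` disjoint odd sets whose neighbours outside of them lie in `B`. -/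
structure IsOddBarrier (G : SimpleGraph V) (B : Finset V) (𝒟 : Finset (Finset V)) : Prop where
  notMem : ∀ D ∈ 𝒟, ∀ x ∈ D, x ∉ B
  eq_of_mem : ∀ D ∈ 𝒟, ∀ D' ∈ 𝒟, ∀ x ∈ D, x ∈ D' → D = D'
  odd : ∀ D ∈ 𝒟, Odd D.card
  adj : ∀ D ∈ 𝒟, ∀ x ∈ D, ∀ y, G.Adj x y → y ∈ D ∨ y ∈ B
  card_le : B.card ≤ 𝒟.card

/-- An odd barrier all of whose odd sets induce factor-critical graphs. -/
structure IsCriticalBarrier [DecidableEq V] (G : SimpleGraph V) (B : Finset V)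
    (𝒟 : Finset (Finset V)) : Prop extends IsOddBarrier G B 𝒟 where
  critical : ∀ D ∈ 𝒟, ∀ d ∈ D, ∃ f, MatchesOn G f (D.erase d : Finset V)

/-- The odd sets adjacent to `A`. -/
noncomputable def adjacentSets (G : SimpleGraph V) (𝒟 : Finset (Finset V)) (A : Finset V) :
    Finset (Finset V) :=
  open Classical in 𝒟.filter fun D => ∃ a ∈ A, ∃ x ∈ D, G.Adj a x

theorem mem_adjacentSets {G : SimpleGraph V} {𝒟 : Finset (Finset V)} {A D : Finset V} :
    D ∈ adjacentSets G 𝒟 A ↔ D ∈ 𝒟 ∧ ∃ a ∈ A, ∃ x ∈ D, G.Adj a x := by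
  simp [adjacentSets]

section

variable [DecidableEq V] {G : SimpleGraph V} {B : Finset V} {𝒟 : Finset (Finset V)} {f : V → V}

theorem IsOddBarrier.card_le_of_forall_mem (h : IsOddBarrier G B 𝒟) {A : Finset V} {I}
    (hI : I ⊆ 𝒟) (hf : MatchesOn G f Set.univ) (hA : ∀ D ∈ I, ∀ x ∈ D, f x ∈ B → f x ∈ A) :
    I.card ≤ A.card := by
  refine card_le_card_of_odd_sets (E := id) (f := f) (fun D hD => h.odd D (hI hD))
    (fun D hD D' hD' => h.eq_of_mem D (hI hD) D' (hI hD')) (fun D hD x hx => ?_)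
  obtain ⟨-, hadj, hinv⟩ := hf x trivial
  exact ⟨hadj.ne', hinv, (h.adj D (hI hD) x hx _ hadj).imp_right (hA D hD x hx)⟩

theorem IsOddBarrier.card_eq (h : IsOddBarrier G B 𝒟) (hf : MatchesOn G f Set.univ) :
    𝒟.card = B.card :=
  le_antisymm (h.card_le_of_forall_mem subset_rfl hf fun _ _ _ _ => id) h.card_le

/-- Otherwise all of `𝒟` would be matched injectively into `B` without `b`, which is too small. -/
theorem IsOddBarrier.exists_mem (h : IsOddBarrier G B 𝒟) (hf : MatchesOn G f Set.univ) {b : V}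
    (hb : b ∈ B) : ∃ D ∈ 𝒟, f b ∈ D := by
  by_contra! hcon
  have := h.card_le_of_forall_mem (A := B.erase b) subset_rfl hf (fun D hD x hx hB =>
    Finset.mem_erase.2 ⟨by
      rintro rfl
      exact hcon D hD ((hf x trivial).2.2.symm ▸ hx), hB⟩)
  have h2 := h.card_le
  have h3 := Finset.card_erase_lt_of_mem hb
  omega

/-- If two barrier vertices were matched into `D`, the other `|𝒟| - 1` odd sets would share only
`|B| - 2` partners. -/
theorem IsOddBarrier.eq_of_mem_of_mem (h : IsOddBarrier G B 𝒟) (hf : MatchesOn G f Set.univ)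
    {b b' : V} (hb : b ∈ B) (hb' : b' ∈ B) {D : Finset V} (hD : D ∈ 𝒟) (hbD : f b ∈ D)
    (hbD' : f b' ∈ D) : b = b' := by
  by_contra hne
  have := h.card_le_of_forall_mem (A := (B.erase b).erase b') (I := 𝒟.erase D)
    (Finset.erase_subset _ _) hf (fun D' hD' x hx hB => by
      obtain ⟨hne', hD'⟩ := Finset.mem_erase.1 hD'
      refine Finset.mem_erase.2 ⟨?_, Finset.mem_erase.2 ⟨?_, hB⟩⟩
      · rintro rfl
        rw [(hf x trivial).2.2] at hbD'
        exact hne' (h.eq_of_mem _ hD' _ hD x hx hbD')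
      · rintro rfl
        rw [(hf x trivial).2.2] at hbD
        exact hne' (h.eq_of_mem _ hD' _ hD x hx hbD))
  have h2 := h.card_le
  have h3 := Finset.card_erase_of_mem hD
  have h4 := Finset.card_erase_of_mem hb
  have h5 := Finset.card_erase_of_mem (Finset.mem_erase.2 ⟨Ne.symm hne, hb'⟩)
  have h6 := Finset.card_pos.2 ⟨b', Finset.mem_erase.2 ⟨Ne.symm hne, hb'⟩⟩
  omega

theorem isOddBarrier_singleton [Fintype V] (hf : MatchesOn G f Set.univ) (u : V) :
    IsOddBarrier G {u} {Finset.univ.erase u} where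
  notMem := by simp
  eq_of_mem := by simp
  odd := by
    have : Even (Finset.univ : Finset V).card := even_card_of_involution (f := f)
      fun v _ => ⟨Finset.mem_univ _, (hf v trivial).2.1.ne', (hf v trivial).2.2⟩
    have h1 := Finset.card_erase_of_mem (Finset.mem_univ u)
    have h2 := Finset.card_pos.2 ⟨u, Finset.mem_univ u⟩
    simp only [Finset.mem_singleton, forall_eq]
    grind
  adj := by simp; tauto
  card_le := by simp

/-- An odd set that is not factor-critical can be split so as to enlarge the barrier. -/
theorem IsOddBarrier.exists_larger [Fintype V] (h : IsOddBarrier G B 𝒟) {D : Finset V}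
    (hD : D ∈ 𝒟) {d : V} (hd : d ∈ D) (hcrit : ¬ ∃ f, MatchesOn G f (D.erase d : Finset V)) :
    ∃ B' 𝒟', IsOddBarrier G B' 𝒟' ∧ B ⊆ B' ∧ B.card < B'.card := by
  have heven : Even (D.erase d).card := by
    have := h.odd D hD
    have h1 := Finset.card_erase_of_mem hd
    have h2 := Finset.card_pos.2 ⟨d, hd⟩
    grind
  obtain ⟨R, 𝒞, hRD, hcard, h𝒞⟩ := exists_oddFamily_of_not_matchesOn heven hcrit
  have hdR : d ∉ R := fun hR => by simpa using hRD hR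
  have hCD : ∀ C ∈ 𝒞, ∀ x ∈ C, x ∈ D ∧ x ≠ d := fun C hC x hx => by
    have := (h𝒞 C hC).2.1 hx
    simp_all
  have hRD' : ∀ x ∈ R, x ∈ D := fun x hx => Finset.mem_of_mem_erase (hRD hx)
  have hBR : Disjoint B (insert d R) := by
    rw [Finset.disjoint_right]
    intro x hx
    rcases Finset.mem_insert.1 hx with rfl | hx
    · exact h.notMem D hD _ hd
    · exact h.notMem D hD _ (hRD' x hx)
  have hDC : Disjoint (𝒟.erase D) 𝒞 := by
    rw [Finset.disjoint_right]
    intro C hC hC'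
    obtain ⟨hne, hC'⟩ := Finset.mem_erase.1 hC'
    obtain ⟨x, hx⟩ := Finset.card_pos.1 (h𝒞 C hC).1.pos
    exact hne (h.eq_of_mem C hC' D hD x hx (hCD C hC x hx).1)
  have hB' : (B ∪ insert d R).card = B.card + (R.card + 1) := by
    rw [Finset.card_union_of_disjoint hBR, Finset.card_insert_of_notMem hdR]
  -- The barrier gains `|R| + 1` vertices; the family loses `D` and gains at least `|R| + 2` sets,
  -- so the balance is kept.
  refine ⟨B ∪ insert d R, 𝒟.erase D ∪ 𝒞, ⟨?_, ?_, ?_, ?_, ?_⟩, Finset.subset_union_left,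
    by omega⟩
  · intro E hE x hx hxB
    rcases Finset.mem_union.1 hE with hE | hE
    · obtain ⟨hne, hE⟩ := Finset.mem_erase.1 hE
      have hxD : x ∉ D := fun hxD => hne (h.eq_of_mem E hE D hD x hx hxD)
      have := h.notMem E hE x hx
      have := hRD' x
      simp only [Finset.mem_union, Finset.mem_insert] at hxB
      rcases hxB with h1 | rfl | h1 <;> tauto
    · have h1 := hCD E hE x hx
      have h2 := (h𝒞 E hE).2.2.1 x hx
      have h3 := h.notMem D hD x h1.1
      simp only [Finset.mem_union, Finset.mem_insert] at hxB
      tauto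
  · intro E hE E' hE' x hx hx'
    simp only [Finset.mem_union, Finset.mem_erase] at hE hE'
    rcases hE with ⟨hne, hE⟩ | hE <;> rcases hE' with ⟨hne', hE'⟩ | hE'
    · exact h.eq_of_mem E hE E' hE' x hx hx'
    · exact absurd (h.eq_of_mem E hE D hD x hx (hCD E' hE' x hx').1) hne
    · exact absurd (h.eq_of_mem E' hE' D hD x hx' (hCD E hE x hx).1) hne'
    · exact (h𝒞 E hE).2.2.2.2 E' hE' x hx hx'
  · intro E hE
    rcases Finset.mem_union.1 hE with hE | hE
    · exact h.odd E (Finset.mem_of_mem_erase hE)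
    · exact (h𝒞 E hE).1
  · intro E hE x hx y hxy
    simp only [Finset.mem_union, Finset.mem_insert]
    rcases Finset.mem_union.1 hE with hE | hE
    · have := h.adj E (Finset.mem_of_mem_erase hE) x hx y hxy
      tauto
    · have h1 := h.adj D hD x (hCD E hE x hx).1 y hxy
      by_cases hyd : y = d
      · tauto
      · have h2 := fun hy => (h𝒞 E hE).2.2.2.1 x hx y (Finset.mem_erase.2 ⟨hyd, hy⟩) hxy
        tauto
  · rw [hB', Finset.card_union_of_disjoint hDC, Finset.card_erase_of_mem hD]
    have := h.card_le
    omega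

theorem exists_isCriticalBarrier [Fintype V] (hf : MatchesOn G f Set.univ) (u : V) :
    ∃ B 𝒟, IsCriticalBarrier G B 𝒟 ∧ u ∈ B := by
  obtain ⟨⟨B, 𝒟⟩, ⟨h, hu⟩, hmax⟩ := Set.exists_max_image
    {p : Finset V × Finset (Finset V) | IsOddBarrier G p.1 p.2 ∧ u ∈ p.1}
    (fun p => p.1.card) (Set.toFinite _) 
      ⟨({u}, {Finset.univ.erase u}), isOddBarrier_singleton hf u, Finset.mem_singleton_self u⟩
  refine ⟨B, 𝒟, ⟨h, fun D hD d hd => ?_⟩, hu⟩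
  by_contra hcrit
  obtain ⟨B', 𝒟', h', hBB', hlt⟩ := h.exists_larger hD hd hcrit
  exact (hmax ⟨B', 𝒟'⟩ ⟨h', hBB' hu⟩).not_gt hlt

/-- A critical barrier containing `u` in which every nonempty subset of `B` avoiding `u` is
adjacent to more odd sets than it has elements. -/
theorem exists_isCriticalBarrier_surplus [Fintype V] (hf : MatchesOn G f Set.univ) (u : V) :
    ∃ B 𝒟, IsCriticalBarrier G B 𝒟 ∧ u ∈ B ∧
      ∀ A ⊆ B, A.Nonempty → u ∉ A → A.card < (adjacentSets G 𝒟 A).card := by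
  obtain ⟨B₀, 𝒟₀, h₀, hu₀⟩ := exists_isCriticalBarrier hf u
  obtain ⟨⟨B, 𝒟⟩, ⟨h, hu⟩, hmin⟩ := Set.exists_min_image
    {p : Finset V × Finset (Finset V) | IsCriticalBarrier G p.1 p.2 ∧ u ∈ p.1}
    (fun p => p.1.card) (Set.toFinite _) ⟨(B₀, 𝒟₀), h₀, hu₀⟩
  refine ⟨B, 𝒟, h, hu, fun A hAB hA huA => ?_⟩
  by_contra! hle
  have hsub : adjacentSets G 𝒟 A ⊆ 𝒟 := fun D hD => (mem_adjacentSets.1 hD).1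
  have hmem : ∀ D ∈ 𝒟 \ adjacentSets G 𝒟 A, D ∈ 𝒟 := fun D hD => (Finset.mem_sdiff.1 hD).1
  -- A set `A` without surplus can be deleted together with its adjacent odd sets, against
  -- minimality.
  have hnew : IsCriticalBarrier G (B \ A) (𝒟 \ adjacentSets G 𝒟 A) := by
    refine ⟨⟨?_, ?_, ?_, ?_, ?_⟩, ?_⟩
    · exact fun D hD x hx hxB => h.notMem D (hmem D hD) x hx (Finset.mem_sdiff.1 hxB).1
    · exact fun D hD D' hD' => h.eq_of_mem D (hmem D hD) D' (hmem D' hD')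
    · exact fun D hD => h.odd D (hmem D hD)
    · intro D hD x hx y hxy
      refine (h.adj D (hmem D hD) x hx y hxy).imp_right fun hy => Finset.mem_sdiff.2 ⟨hy, ?_⟩
      intro hyA
      exact (Finset.mem_sdiff.1 hD).2 (mem_adjacentSets.2 ⟨hmem D hD, y, hyA, x, hx, hxy.symm⟩)
    · rw [Finset.card_sdiff_of_subset hAB, Finset.card_sdiff_of_subset hsub]
      have : B.card ≤ 𝒟.card := h.card_le
      omega
    · exact fun D hD => h.critical D (hmem D hD)
  have h1 := hmin (B \ A, 𝒟 \ adjacentSets G 𝒟 A) ⟨hnew, Finset.mem_sdiff.2 ⟨hu, huA⟩⟩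
  have h2 := Finset.card_pos.2 hA
  have h3 := Finset.card_le_card hAB
  rw [Finset.card_sdiff_of_subset hAB] at h1
  simp only at h1
  omega

end

/-! ### Allowed edges at a barrier -/

theorem mem_of_reachable {H : SimpleGraph V} {Z : Set V}
    (hZ : ∀ x y, H.Adj x y → x ∈ Z → y ∈ Z) {x y : V} (h : H.Reachable x y) (hx : x ∈ Z) :
    y ∈ Z := by
  obtain ⟨p⟩ := h
  induction p with
  | nil => exact hx
  | cons hadj _ ih => exact ih (hZ _ _ hadj hx)

section

variable [DecidableEq V] {G : SimpleGraph V} {B : Finset V} {𝒟 : Finset (Finset V)} {f : V → V}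

/-- Extends the surplus to sets containing `u` but not `t`. Without surplus, every perfect matching
uses up all odd sets adjacent to `A` on `A` itself, so `A` with these sets is closed under allowed
edges and cannot be left on the way from `u` to `t`. -/
theorem IsOddBarrier.card_lt_adjacentSets (h : IsOddBarrier G B 𝒟) {u t : V}
    (hsurplus : ∀ A ⊆ B, A.Nonempty → u ∉ A → A.card < (adjacentSets G 𝒟 A).card)
    (ht : t ∈ B) (hut : (allowedGraph G).Reachable u t)
    {A : Finset V} (hAB : A ⊆ B) (hA : A.Nonempty) (htA : t ∉ A) :
    A.card < (adjacentSets G 𝒟 A).card := by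
  by_contra! hle
  have hu : u ∈ A := by
    by_contra huA
    exact (hsurplus A hAB hA huA).not_ge hle
  have hclosed : ∀ x y, (allowedGraph G).Adj x y →
      x ∈ {x | x ∈ A ∨ ∃ D ∈ adjacentSets G 𝒟 A, x ∈ D} →
      y ∈ {x | x ∈ A ∨ ∃ D ∈ adjacentSets G 𝒟 A, x ∈ D} := by
    intro x y hxy hx
    obtain ⟨f, hf, rfl⟩ := allowedGraph_adj_iff.1 hxy
    have hfA : ∀ a ∈ A, ∃ D ∈ adjacentSets G 𝒟 A, f a ∈ D := by
      intro a ha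
      obtain ⟨D, hD, haD⟩ := h.exists_mem hf (hAB ha)
      exact ⟨D, mem_adjacentSets.2 ⟨hD, a, ha, _, haD, (hf a trivial).2.1⟩, haD⟩
    rcases hx with hx | ⟨D, hD, hx⟩
    · exact Or.inr (hfA x hx)
    · have hD𝒟 := (mem_adjacentSets.1 hD).1
      rcases h.adj D hD𝒟 x hx _ (hf x trivial).2.1 with hfx | hfx
      · exact Or.inr ⟨D, hD, hfx⟩
      · left
        by_contra hfxA
        have hffx := (hf x trivial).2.2
        have hins : ∀ a ∈ insert (f x) A, ∃ D ∈ adjacentSets G 𝒟 A, f a ∈ D := by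
          intro a ha
          rcases Finset.mem_insert.1 ha with rfl | ha
          · exact ⟨D, hD, hffx.symm ▸ hx⟩
          · exact hfA a ha
        choose! g hg hfg using hins
        have hsub : insert (f x) A ⊆ B := Finset.insert_subset hfx hAB
        have := Finset.card_le_card_of_injOn g hg (fun a ha b hb hab =>
          h.eq_of_mem_of_mem hf (hsub ha) (hsub hb) (mem_adjacentSets.1 (hg a ha)).1
            (hfg a ha) (hab ▸ hfg b hb))
        rw [Finset.card_insert_of_notMem hfxA] at this
        omega
  rcases mem_of_reachable hclosed hut (Or.inl hu) with h1 | ⟨D, hD, h1⟩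
  · exact htA h1
  · exact h.notMem D (mem_adjacentSets.1 hD).1 t h1 ht

/-- Edges between the odd sets and the vertices of the barrier in the factor-component of `u`
are allowed. -/
theorem IsCriticalBarrier.allowedGraph_adj (h : IsCriticalBarrier G B 𝒟)
    (hf : MatchesOn G f Set.univ) {u t : V}
    (hsurplus : ∀ A ⊆ B, A.Nonempty → u ∉ A → A.card < (adjacentSets G 𝒟 A).card)
    (ht : t ∈ B) (hut : (allowedGraph G).Reachable u t)
    {D : Finset V} (hD : D ∈ 𝒟) {d : V} (hd : d ∈ D) (htd : G.Adj t d) :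
    (allowedGraph G).Adj t d := by
  classical
  -- The surplus preserves Hall's condition for `B - t` after the loss of `D`.
  obtain ⟨ψ, hψinj, hψ⟩ := (Finset.all_card_le_biUnion_card_iff_exists_injective
    (fun b : {b // b ∈ B.erase t} => (adjacentSets G 𝒟 {b.1}).erase D)).1 (by
      intro s
      rcases s.eq_empty_or_nonempty with rfl | hs
      · simp
      have hlt := h.card_lt_adjacentSets hsurplus ht hut
        (A := s.map (Function.Embedding.subtype _))
        (fun b hb => by
          obtain ⟨b, -, rfl⟩ := Finset.mem_map.1 hb
          exact Finset.mem_of_mem_erase b.2)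
        (hs.map) (fun hb => by
          obtain ⟨b, -, hb⟩ := Finset.mem_map.1 hb
          exact Finset.ne_of_mem_erase b.2 hb)
      have hsub : (adjacentSets G 𝒟 (s.map (Function.Embedding.subtype _))).erase D ⊆
          s.biUnion (fun b => (adjacentSets G 𝒟 {b.1}).erase D) := by
        intro E hE
        obtain ⟨hne, hE⟩ := Finset.mem_erase.1 hE
        obtain ⟨hE, a, ha, hx⟩ := mem_adjacentSets.1 hE
        obtain ⟨b, hb, rfl⟩ := Finset.mem_map.1 ha
        exact Finset.mem_biUnion.2 ⟨b, hb, Finset.mem_erase.2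
          ⟨hne, mem_adjacentSets.2 ⟨hE, _, Finset.mem_singleton_self _, hx⟩⟩⟩
      have h1 := Finset.card_le_card hsub
      have h2 := Finset.pred_card_le_card_erase
        (s := adjacentSets G 𝒟 (s.map (Function.Embedding.subtype _))) (a := D)
      rw [Finset.card_map] at hlt
      omega)
  have hψ' : ∀ b, ψ b ∈ 𝒟.erase D ∧ ∃ x ∈ ψ b, G.Adj b x := by
    intro b
    have := hψ b
    simp only [Finset.mem_erase, mem_adjacentSets, Finset.mem_singleton, exists_eq_left] at this
    exact ⟨Finset.mem_erase.2 ⟨this.1, this.2.1⟩, this.2.2⟩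
  choose hψD x hx hbx using hψ'
  have hψ𝒟 : ∀ b, ψ b ∈ 𝒟 := fun b => Finset.mem_of_mem_erase (hψD b)
  have hsurj : ∀ E ∈ 𝒟, E ≠ D → ∃ b, ψ b = E := by
    intro E hE hne
    have himg : Finset.univ.image ψ = 𝒟.erase D := by
      refine Finset.eq_of_subset_of_card_le (fun E hE => ?_) ?_
      · obtain ⟨b, -, rfl⟩ := Finset.mem_image.1 hE
        exact hψD b
      · rw [Finset.card_image_of_injective _ hψinj, Finset.card_erase_of_mem hD]
        simp [Finset.card_erase_of_mem ht, h.card_eq hf]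
    have : E ∈ Finset.univ.image ψ := himg ▸ Finset.mem_erase.2 ⟨hne, hE⟩
    simpa using this
  -- A perfect matching of `G - t - d`: each `b` with its odd set, the rest of `D`, and `f` outside
  -- the barrier and the odd sets.
  set W : {b // b ∈ B.erase t} → Set V :=
    fun b => {(b : V), x b} ∪ ((ψ b).erase (x b) : Finset V) with hW
  have hmemW : ∀ b v, v ∈ W b ↔ v = b ∨ v ∈ ψ b := by
    intro b v
    have := hx b
    simp only [hW, Set.mem_union, Set.mem_insert_iff, Set.mem_singleton_iff, Finset.mem_coe,
      Finset.mem_erase]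
    by_cases hv : v = x b
    · subst hv; tauto
    · tauto
  have hbB : ∀ b : {b // b ∈ B.erase t}, (b : V) ∈ B := fun b => Finset.mem_of_mem_erase b.2
  have hW1 : ∃ g, MatchesOn G g (⋃ b, W b) := by
    refine exists_matchesOn_iUnion (fun b => ?_) (fun b b' v hv hv' => ?_)
    · refine exists_matchesOn_union (exists_matchesOn_pair (hbx b))
        (h.critical _ (hψ𝒟 b) _ (hx b)) ?_
      rw [Set.disjoint_left]
      rintro v (rfl | rfl) hv
      · exact h.notMem _ (hψ𝒟 b) _ (Finset.mem_of_mem_erase hv) (hbB b)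
      · simp at hv
    · rw [hmemW] at hv hv'
      rcases hv with hv | hv <;> rcases hv' with hv' | hv'
      · exact Subtype.ext (hv.symm.trans hv')
      · exact absurd (hv ▸ hbB b) (h.notMem _ (hψ𝒟 b') _ hv')
      · exact absurd (hv' ▸ hbB b') (h.notMem _ (hψ𝒟 b) _ hv)
      · exact hψinj (h.eq_of_mem _ (hψ𝒟 b) _ (hψ𝒟 b') _ hv hv')
  have hC : ∃ g, MatchesOn G g {v | v ∉ B ∧ ∀ E ∈ 𝒟, v ∉ E} := by
    refine ⟨f, fun v hv => ⟨⟨fun hB => ?_, fun E hE hvE => ?_⟩, (hf v trivial).2⟩⟩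
    · obtain ⟨E, hE, hvE⟩ := h.exists_mem hf hB
      rw [(hf v trivial).2.2] at hvE
      exact hv.2 E hE hvE
    · rcases h.adj E hE _ hvE _ (hf v trivial).2.1.symm with h1 | h1
      · exact hv.2 E hE h1
      · exact hv.1 h1
  have hall := exists_matchesOn_union (exists_matchesOn_union hW1 hC (by
    rw [Set.disjoint_left]
    intro v hv hvC
    obtain ⟨b, hb⟩ := Set.mem_iUnion.1 hv
    rcases (hmemW b v).1 hb with rfl | hb
    · exact hvC.1 (hbB b)
    · exact hvC.2 _ (hψ𝒟 b) hb)) (h.critical D hD d hd) (by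
    rw [Set.disjoint_right]
    intro v hv hvC
    have hvD := Finset.mem_of_mem_erase hv
    rcases hvC with hvC | hvC
    · obtain ⟨b, hb⟩ := Set.mem_iUnion.1 hvC
      rcases (hmemW b v).1 hb with rfl | hb
      · exact h.notMem D hD _ hvD (hbB b)
      · exact Finset.ne_of_mem_erase (hψD b) (h.eq_of_mem _ (hψ𝒟 b) _ hD v hb hvD)
    · exact hvC.2 D hD hvD)
  refine allowedGraph_adj_of_matchesOn htd ?_
  convert hall using 3
  ext v
  simp only [Set.mem_compl_iff, Set.mem_insert_iff, Set.mem_singleton_iff, Set.mem_union,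
    Set.mem_iUnion, Finset.coe_erase, Set.mem_sdiff, Finset.mem_coe, hmemW]
  constructor
  · intro hv
    push Not at hv
    by_cases hvB : v ∈ B
    · exact Or.inl (Or.inl ⟨⟨v, Finset.mem_erase.2 ⟨hv.1, hvB⟩⟩, Or.inl rfl⟩)
    by_cases hvE : ∃ E ∈ 𝒟, v ∈ E
    · obtain ⟨E, hE, hvE⟩ := hvE
      by_cases hED : E = D
      · exact Or.inr ⟨hED ▸ hvE, hv.2⟩
      · obtain ⟨b, rfl⟩ := hsurj E hE hED
        exact Or.inl (Or.inl ⟨b, Or.inr hvE⟩)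
    · push Not at hvE
      exact Or.inl (Or.inr ⟨hvB, hvE⟩)
  · rintro ((⟨b, rfl | hb⟩ | hv) | hv)
    · rintro (h1 | rfl)
      · exact Finset.ne_of_mem_erase b.2 h1
      · exact h.notMem D hD _ hd (hbB b)
    · rintro (rfl | rfl)
      · exact h.notMem _ (hψ𝒟 b) _ hb ht
      · exact Finset.ne_of_mem_erase (hψD b) (h.eq_of_mem _ (hψ𝒟 b) _ hD _ hb hd)
    · rintro (rfl | rfl)
      · exact hv.1 ht
      · exact hv.2 D hD hd
    · rintro (rfl | rfl)
      · exact h.notMem D hD _ hv.1 ht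
      · exact hv.2 rfl

end

/-! ### Sets closed under allowed edges -/

/-- A set of vertices is closed under allowed edges. -/
def IsAllowedClosed (G : SimpleGraph V) (X : Set V) : Prop :=
  ∀ x y, (allowedGraph G).Adj x y → x ∈ X → y ∈ X

theorem IsAllowedClosed.apply_mem {G : SimpleGraph V} {X : Set V} (h : IsAllowedClosed G X)
    {f : V → V} (hf : MatchesOn G f Set.univ) {x : V} (hx : x ∈ X) : f x ∈ X :=
  h _ _ (allowedGraph_adj_iff.2 ⟨f, hf, rfl⟩) hx

theorem IsAllowedClosed.inter {G : SimpleGraph V} {X Y : Set V} (hX : IsAllowedClosed G X)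
    (hY : IsAllowedClosed G Y) : IsAllowedClosed G (X ∩ Y) :=
  fun x y h hx => ⟨hX x y h hx.1, hY x y h hx.2⟩

section

variable [DecidableEq V] {G : SimpleGraph V} {B : Finset V} {𝒟 : Finset (Finset V)} {f : V → V}

/-- The odd set matched to `b` meets a set closed under allowed edges in an odd number of
vertices if that set contains `b`. -/
theorem IsOddBarrier.odd_card_filter (h : IsOddBarrier G B 𝒟) (hf : MatchesOn G f Set.univ)
    {Y : Set V} [DecidablePred (· ∈ Y)] (hY : IsAllowedClosed G Y) {b : V} (hb : b ∈ B)
    (hbY : b ∈ Y) {D : Finset V}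
    (hD : D ∈ 𝒟) (hbD : f b ∈ D) : Odd (D.filter (· ∈ Y)).card := by
  have hmem : f b ∈ D.filter (· ∈ Y) := Finset.mem_filter.2 ⟨hbD, hY.apply_mem hf hbY⟩
  -- The edge from `b` to `f b` is the only edge of `f` between `D` and `B`, so `f` pairs up the
  -- rest of `D ∩ Y`.
  have heven : Even ((D.filter (· ∈ Y)).erase (f b)).card := by
    refine even_card_of_involution (f := f) fun x hx => ?_
    obtain ⟨hne, hx⟩ := Finset.mem_erase.1 hx
    obtain ⟨hxD, hxY⟩ := Finset.mem_filter.1 hx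
    obtain ⟨-, hadj, hinv⟩ := hf x trivial
    refine ⟨Finset.mem_erase.2 ⟨fun heq => ?_, Finset.mem_filter.2 ⟨?_, hY.apply_mem hf hxY⟩⟩,
      hadj.ne', hinv⟩
    · have : x = b := by rw [← hinv, heq, (hf b trivial).2.2]
      exact h.notMem D hD x hxD (this ▸ hb)
    · refine (h.adj D hD x hxD _ hadj).resolve_right fun hB => hne ?_
      rw [← h.eq_of_mem_of_mem hf hB hb hD (hinv.symm ▸ hxD) hbD, hinv]
  have h1 := Finset.card_erase_of_mem hmem
  have h2 := Finset.card_pos.2 ⟨_, hmem⟩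
  grind

/-- An odd set matched to a vertex of a set `Y` closed under allowed edges is disjoint from every
factor-component `Z` disjoint from `Y` that meets the barrier. -/
theorem IsOddBarrier.notMem_of_disjoint (h : IsOddBarrier G B 𝒟) (hf : MatchesOn G f Set.univ)
    {Y Z : Set V} (hY : IsAllowedClosed G Y) (hZ : IsAllowedClosed G Z) (hYZ : ∀ x ∈ Y, x ∉ Z)
    (hconn : ∀ x ∈ Z, ∀ y ∈ Z, (allowedGraph G).Reachable x y) {u : V} (hu : u ∈ B)
    (huZ : u ∈ Z) {b : V} (hb : b ∈ B) (hbY : b ∈ Y) {D : Finset V} (hD : D ∈ 𝒟)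
    (hbD : f b ∈ D) {w : V} (hw : w ∈ D) : w ∉ Z := by
  classical
  intro hwZ
  have hex : ∃ p q, (allowedGraph G).Adj p q ∧ p ∈ D ∧ p ∈ Z ∧ q ∉ D := by
    by_contra! hcon
    have : u ∈ {p | p ∈ D ∧ p ∈ Z} := mem_of_reachable (Z := {p | p ∈ D ∧ p ∈ Z})
      (fun p q hpq hp => ⟨hcon p q hpq hp.1 hp.2, hZ p q hpq hp.2⟩) (hconn w hwZ u huZ) ⟨hw, hwZ⟩
    exact h.notMem D hD u this.1 hu
  obtain ⟨p, q, hpq, hpD, hpZ, hqD⟩ := hex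
  have hqZ := hZ p q hpq hpZ
  obtain ⟨g, hg, rfl⟩ := allowedGraph_adj_iff.1 hpq
  have hqB := (h.adj D hD p hpD _ (hg p trivial).2.1).resolve_left hqD
  -- The only edge of `g` leaving `D` ends at `g p ∈ Z`, hence outside `Y`. So `g` pairs up `D ∩ Y`,
  -- whose size is odd because of `f`.
  refine Nat.not_even_iff_odd.2 (h.odd_card_filter hf hY hb hbY hD hbD)
    (even_card_of_involution (f := g) fun x hx => ?_)
  obtain ⟨hxD, hxY⟩ := Finset.mem_filter.1 hx
  obtain ⟨-, hadj, hinv⟩ := hg x trivial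
  refine ⟨Finset.mem_filter.2 ⟨?_, hY.apply_mem hg hxY⟩, hadj.ne', hinv⟩
  refine (h.adj D hD x hxD _ hadj).resolve_right fun hB => ?_
  have := h.eq_of_mem_of_mem hg hB hqB hD (hinv.symm ▸ hxD) ((hg p trivial).2.2.symm ▸ hpD)
  exact hYZ _ (hY.apply_mem hg hxY) (this ▸ hqZ)

end

/-! ### The contradiction -/

/-- If `Z` is a factor-component and `K` is a connected set disjoint from `Z`, closed under allowed
edges, each vertex of which lies in a critical-inducing set for `Z` having no further neighbours
of `K`, then deleting two distinct neighbours of `K` in `Z` leaves no perfect matching. -/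
theorem not_matchesOn_of_adj [Fintype V] [DecidableEq V] {G : SimpleGraph V} {f : V → V}
    (hf : MatchesOn G f Set.univ) {K Z : Set V} (hK : IsAllowedClosed G K)
    (hZ : IsAllowedClosed G Z) (hKZ : ∀ x ∈ K, x ∉ Z)
    (hZconn : ∀ x ∈ Z, ∀ y ∈ Z, (allowedGraph G).Reachable x y)
    (hKconn : ∀ P : Set V, (∀ a ∈ K, ∀ b ∈ K, G.Adj a b → a ∈ P → b ∈ P) →
      ∀ x ∈ K, ∀ y ∈ K, x ∈ P → y ∈ P)
    (hcrit : ∀ b ∈ K, ∃ X : Set V, IsAllowedClosed G X ∧ b ∈ X ∧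
      (∀ x ∈ K, ∀ y ∈ X, G.Adj x y → y ∈ K ∨ y ∈ Z) ∧
      ∃ N : V → V, ∀ x ∈ X, x ∉ Z → x ≠ b →
        N x ∈ X ∧ G.Adj x (N x) ∧ N x ≠ b ∧ (N x ∉ Z → N (N x) = x))
    {u v x y : V} (hu : u ∈ Z) (hv : v ∈ Z) (huv : u ≠ v) (hx : x ∈ K) (hy : y ∈ K)
    (hxu : G.Adj x u) (hyv : G.Adj y v) : ¬ ∃ g, MatchesOn G g {u, v}ᶜ := by
  classical
  rintro ⟨g, hg⟩
  obtain ⟨B, 𝒟, h, huB, hsurplus⟩ := exists_isCriticalBarrier_surplus hf u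
  -- With `u` and `v` both in `B`, `g` would match `𝒟` into `B` less two vertices.
  have hvB : v ∉ B := by
    intro hvB
    have hmem : v ∈ B.erase u := Finset.mem_erase.2 ⟨huv.symm, hvB⟩
    have := card_le_card_of_odd_sets (I := 𝒟) (E := id) (A := (B.erase u).erase v) (f := g)
      (fun D hD => h.odd D hD) (fun D hD D' hD' => h.eq_of_mem D hD D' hD') (fun D hD a ha => by
        have hau : a ≠ u := fun e => h.notMem D hD a ha (e ▸ huB)
        have hav : a ≠ v := fun e => h.notMem D hD a ha (e ▸ hvB)
        obtain ⟨h1, h2, h3⟩ := hg a (by simp [hau, hav])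
        simp only [Set.mem_compl_iff, Set.mem_insert_iff, Set.mem_singleton_iff, not_or] at h1
        exact ⟨h2.ne', h3, (h.adj D hD a ha _ h2).imp_right fun hB =>
          Finset.mem_erase.2 ⟨h1.2, Finset.mem_erase.2 ⟨h1.1, hB⟩⟩⟩)
    have h1 := h.card_le
    have h2 := Finset.card_erase_lt_of_mem hmem
    have h3 := Finset.card_erase_lt_of_mem huB
    omega
  have hvD : ∃ D ∈ 𝒟, v ∈ D := by
    have : v ∈ {w | w ∈ B ∨ ∃ D ∈ 𝒟, w ∈ D} := mem_of_reachable (fun p q hpq hp => by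
      obtain ⟨f', hf', rfl⟩ := allowedGraph_adj_iff.1 hpq
      rcases hp with hp | ⟨D, hD, hp⟩
      · exact Or.inr (h.exists_mem hf' hp)
      · exact (h.adj D hD p hp _ (hf' p trivial).2.1).symm.imp_right fun hq => ⟨D, hD, hq⟩)
      (hZconn u hu v hv) (Or.inl huB)
    exact this.resolve_left hvB
  have hTD : ∀ D ∈ 𝒟, ∀ d ∈ D, d ∈ K → ∀ t ∈ B, t ∈ Z → ¬ G.Adj d t := by
    intro D hD d hd hdK t ht htZ hadj
    have := h.allowedGraph_adj hf hsurplus ht (hZconn u hu t htZ) hD hd hadj.symm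
    exact hKZ t (hK d t this.symm hdK) htZ
  have hDZ : ∀ b ∈ B, b ∈ K → ∀ D ∈ 𝒟, f b ∈ D → ∀ d ∈ D, d ∈ K → ∀ w ∈ Z, ¬ G.Adj d w := by
    intro b hb hbK D hD hbD d hd hdK w hw hadj
    rcases h.adj D hD d hd w hadj with hwD | hwB
    · exact h.notMem_of_disjoint hf hK hZ hKZ hZconn huB hu hb hbK hD hbD hwD hw
    · exact hTD D hD d hd hdK w hwB hw hadj
  have hKB : ∀ b ∈ K, b ∉ B := by
    intro b hbK hb
    obtain ⟨X, hX, hbX, hKX, N, hN⟩ := hcrit b hbK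
    have hKX' := hK.inter hX
    choose! D hD hfD using fun i hi => h.exists_mem (b := i) hf hi
    have hbmem : b ∈ B.filter (· ∈ K ∩ X) := Finset.mem_filter.2 ⟨hb, hbK, hbX⟩
    have hB' : ∀ i ∈ B.filter (· ∈ K ∩ X), i ∈ B ∧ i ∈ K ∩ X := fun i => Finset.mem_filter.1
    -- By `hDZ`, `N` sends no vertex of these traces into `Z`; it stays in `K ∩ X`, is an involution
    -- there, and avoids `b`. The traces thus outnumber their possible partners by one.
    have := card_le_card_of_odd_sets (I := B.filter (· ∈ K ∩ X))
      (E := fun i => (D i).filter (· ∈ K ∩ X)) (A := (B.filter (· ∈ K ∩ X)).erase b) (f := N)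
      (fun i hi => h.odd_card_filter hf hKX' (hB' i hi).1 (hB' i hi).2 (hD i (hB' i hi).1)
        (hfD i (hB' i hi).1))
      (fun i hi j hj a hai haj => by
        have hi := (hB' i hi).1
        have hj := (hB' j hj).1
        have heq := h.eq_of_mem _ (hD i hi) _ (hD j hj) a (Finset.mem_filter.1 hai).1
          (Finset.mem_filter.1 haj).1
        exact h.eq_of_mem_of_mem hf hi hj (hD i hi) (hfD i hi) (heq ▸ hfD j hj))
      (fun i hi a ha => by
        obtain ⟨hi, hiK, -⟩ := hB' i hi
        obtain ⟨haD, haK, haX⟩ := Finset.mem_filter.1 ha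
        have hab : a ≠ b := fun e => h.notMem _ (hD i hi) a haD (e ▸ hb)
        obtain ⟨h1, h2, h3, h4⟩ := hN a haX (hKZ a haK) hab
        have hNZ : N a ∉ Z := fun hz =>
          hDZ i hi hiK _ (hD i hi) (hfD i hi) a haD haK _ hz h2
        have hNK := (hKX a haK _ h1 h2).resolve_right hNZ
        refine ⟨h2.ne', h4 hNZ, (h.adj _ (hD i hi) a haD _ h2).imp (fun hD => ?_) fun hB => ?_⟩
        · exact Finset.mem_filter.2 ⟨hD, hNK, h1⟩
        · exact Finset.mem_erase.2 ⟨h3, Finset.mem_filter.2 ⟨hB, hNK, h1⟩⟩)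
    exact this.not_gt (Finset.card_erase_lt_of_mem hbmem)
  have hyD : y ∈ {p | ∀ D ∈ 𝒟, p ∉ D} := by
    refine hKconn {p | ∀ D ∈ 𝒟, p ∉ D} (fun a ha b _ hab haD D hD hbD => ?_) x hx y hy
      fun D hD hxD => hTD D hD x hxD hx u huB hu hxu
    rcases h.adj D hD b hbD a hab.symm with h1 | h1
    · exact haD D hD h1
    · exact hKB a ha h1
  obtain ⟨D, hD, hvD⟩ := hvD
  rcases h.adj D hD v hvD y hyv.symm with h1 | h1
  · exact hyD D hD h1
  · exact hKB y hy h1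

/-! ### Contractions, factor-components and the conclusion -/

/-- Outside of the contracted set, a factor-critical contraction gives a near-perfect matching
some of whose vertices are matched into the contracted set. -/
theorem exists_partner_of_isFactorCritical_contract {H : SimpleGraph V} {S : Set V}
    (h : IsFactorCritical (contract H S)) (b : V) :
    ∃ N : V → V, ∀ x, x ∉ S → x ≠ b →
      H.Adj x (N x) ∧ N x ≠ b ∧ (N x ∉ S → N (N x) = x) := by
  -- No edge of `H[S]` meets a vertex outside `S`, so such a vertex survives as a singleton class.
  have hsingle : ∀ x, x ∉ S → ∀ y, (edgesWithin H S).connectedComponentMk x =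
      (edgesWithin H S).connectedComponentMk y → x = y := by
    intro x hx y hxy
    have := mem_of_reachable (Z := {x}) (fun p q hpq hp => by
      obtain rfl : p = x := hp
      simp [edgesWithin] at hpq
      exact absurd hpq.1 hx) (SimpleGraph.ConnectedComponent.exact hxy) rfl
    exact this.symm
  obtain ⟨g, hg⟩ := isFactorizable_induce_iff.1
    (h ((edgesWithin H S).connectedComponentMk b))
  have hex : ∀ x, ∃ z, x ∉ S → x ≠ b → H.Adj x z ∧
      (edgesWithin H S).connectedComponentMk z =
        g ((edgesWithin H S).connectedComponentMk x) := by
    intro x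
    by_cases hx : x ∉ S ∧ x ≠ b
    · have := (hg ((edgesWithin H S).connectedComponentMk x)
        (fun e => hx.2 (hsingle x hx.1 b e))).2.1
      obtain ⟨-, a, z, haz, ha, hz⟩ := this
      obtain rfl := hsingle x hx.1 a ha.symm
      exact ⟨z, fun _ _ => ⟨haz, hz⟩⟩
    · exact ⟨x, fun h1 h2 => absurd ⟨h1, h2⟩ hx⟩
  choose N hN using hex
  refine ⟨N, fun x hx hxb => ?_⟩
  obtain ⟨hadj, hmk⟩ := hN x hx hxb
  have hgx := hg ((edgesWithin H S).connectedComponentMk x) (fun e => hxb (hsingle x hx b e))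
  have hNb : N x ≠ b := by
    intro e
    rw [e] at hmk
    exact hgx.1 hmk.symm
  refine ⟨hadj, hNb, fun hNS => ?_⟩
  have := (hN (N x) hNS hNb).2
  rw [hmk, hgx.2.2] at this
  exact (hsingle x hx _ this.symm).symm

theorem isAllowedClosed_verts {G : SimpleGraph V} {H : G.Subgraph}
    (hH : H ∈ factorComponents G) : IsAllowedClosed G H.verts := by
  obtain ⟨C, rfl⟩ := hH
  exact fun x y hxy hx => C.mem_supp_of_adj_mem_supp hx hxy

theorem eq_of_mem_verts {G : SimpleGraph V} {H H' : G.Subgraph} (hH : H ∈ factorComponents G)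
    (hH' : H' ∈ factorComponents G) {x : V} (hx : x ∈ H.verts) (hx' : x ∈ H'.verts) :
    H = H' := by
  obtain ⟨C, rfl⟩ := hH
  obtain ⟨C', rfl⟩ := hH'
  have h1 : (allowedGraph G).connectedComponentMk x = C := hx
  have h2 : (allowedGraph G).connectedComponentMk x = C' := hx'
  rw [← h1, ← h2]

theorem exists_mem_factorComponents (G : SimpleGraph V) (x : V) :
    ∃ H ∈ factorComponents G, x ∈ H.verts :=
  ⟨_, ⟨(allowedGraph G).connectedComponentMk x, rfl⟩, rfl⟩

theorem IsSeparating.verts_subset {G : SimpleGraph V} {X : Set V} (hX : IsSeparating G X)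
    {H : G.Subgraph} (hH : H ∈ factorComponents G) {x : V} (hx : x ∈ X) (hxH : x ∈ H.verts) :
    H.verts ⊆ X :=
  (hX H hH).resolve_right fun h => (h ▸ ⟨hxH, hx⟩ : x ∈ (∅ : Set V))

theorem IsSeparating.isAllowedClosed {G : SimpleGraph V} {X : Set V} (hX : IsSeparating G X) :
    IsAllowedClosed G X := by
  intro x y hxy hx
  obtain ⟨H, hH, hxH⟩ := exists_mem_factorComponents G x
  exact hX.verts_subset hH hx hxH (isAllowedClosed_verts hH x y hxy hxH)

theorem IsCriticalInducing.mem_strictUpperVerts {G : SimpleGraph V} {G₀ : G.Subgraph}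
    {X : Set V} (hX : IsCriticalInducing G G₀ X) {x : V} (hx : x ∈ X) (hx₀ : x ∉ G₀.verts) :
    x ∈ strictUpperVerts G G₀ := by
  obtain ⟨H, hH, hxH⟩ := exists_mem_factorComponents G x
  exact ⟨H, ⟨hH, ⟨X, hX, hX.1.verts_subset hH hx hxH⟩, fun e => hx₀ (e ▸ hxH)⟩, hxH⟩

theorem IsCriticalInducing.exists_partner {G : SimpleGraph V} {G₀ : G.Subgraph}
    {X : Set V} (hX : IsCriticalInducing G G₀ X) {b : V} (hb : b ∈ X) :
    ∃ N : V → V, ∀ x ∈ X, x ∉ G₀.verts → x ≠ b →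
      N x ∈ X ∧ G.Adj x (N x) ∧ N x ≠ b ∧ (N x ∉ G₀.verts → N (N x) = x) := by
  classical
  obtain ⟨N, hN⟩ := exists_partner_of_isFactorCritical_contract hX.2.2 ⟨b, hb⟩
  refine ⟨fun x => if h : x ∈ X then N ⟨x, h⟩ else x, fun x hx hx₀ hxb => ?_⟩
  obtain ⟨h1, h2, h3⟩ := hN ⟨x, hx⟩ hx₀ (fun e => hxb (congrArg Subtype.val e))
  simp only [hx, dif_pos, Subtype.coe_prop, true_and]
  exact ⟨h1, fun e => h2 (Subtype.ext e), fun h => congrArg Subtype.val (h3 h)⟩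

theorem kotzigRel_of_mem_neighbours [Finite V] {G : SimpleGraph V} (hG : IsFactorizable G)
    {G₀ : G.Subgraph} (hG₀ : G₀ ∈ factorComponents G)
    (K : (G.induce (strictUpperVerts G G₀)).ConnectedComponent) {u v : V}
    (hu : u ∈ neighbours G (Subtype.val '' K.supp) ∩ G₀.verts)
    (hv : v ∈ neighbours G (Subtype.val '' K.supp) ∩ G₀.verts) : KotzigRel G u v := by
  classical
  cases nonempty_fintype V
  by_contra hrel
  obtain ⟨huv, hfac⟩ := not_or.1 hrel
  obtain ⟨⟨-, x, hx, hxu⟩, hu⟩ := hu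
  obtain ⟨⟨-, y, hy, hyv⟩, hv⟩ := hv
  obtain ⟨f, hf⟩ := isFactorizable_iff.1 hG
  have hadjK : ∀ a ∈ Subtype.val '' K.supp, ∀ b ∈ strictUpperVerts G G₀, G.Adj a b →
      b ∈ Subtype.val '' K.supp := by
    rintro _ ⟨a, ha, rfl⟩ b hb hab
    exact ⟨⟨b, hb⟩, K.mem_supp_of_adj_mem_supp ha (by exact hab), rfl⟩
  have hKZ : ∀ a ∈ Subtype.val '' K.supp, a ∉ G₀.verts := by
    rintro _ ⟨⟨a, I, hI, haI⟩, -, rfl⟩ ha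
    exact hI.2.2 (eq_of_mem_verts hI.1 hG₀ haI ha)
  refine not_matchesOn_of_adj hf (K := Subtype.val '' K.supp) (Z := G₀.verts) ?_
    (isAllowedClosed_verts hG₀) hKZ ?_ ?_ ?_ hu hv huv hx hy hxu hyv
    (isFactorizable_induce_iff.1 (not_not.1 hfac))
  · intro a b hab ha
    obtain ⟨M, -, hM⟩ := id hab
    obtain ⟨⟨a, I, hI, haI⟩, -, rfl⟩ := id ha
    exact hadjK _ ha b ⟨I, hI, isAllowedClosed_verts hI.1 _ _ hab haI⟩ hM.adj_sub
  · obtain ⟨C, rfl⟩ := hG₀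
    intro a ha b hb
    exact C.reachable_of_mem_supp ha hb
  · rintro P hP _ ⟨a, ha, rfl⟩ _ ⟨b, hb, rfl⟩ haP
    have := mem_of_reachable (Z := {p | p ∈ K.supp ∧ (p : V) ∈ P}) (fun p q hpq hp => by
      have hq := K.mem_supp_of_adj_mem_supp hp.1 hpq
      exact ⟨hq, hP _ ⟨p, hp.1, rfl⟩ _ ⟨q, hq, rfl⟩ hpq hp.2⟩)
      (K.reachable_of_mem_supp ha hb) ⟨ha, haP⟩
    exact this.2
  · intro b hb
    obtain ⟨⟨b, I, hI, hbI⟩, -, rfl⟩ := id hb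
    obtain ⟨X, hX, hIX⟩ := hI.2.1
    refine ⟨X, hX.1.isAllowedClosed, hIX hbI, fun p hp q hq hpq => ?_,
      hX.exists_partner (hIX hbI)⟩
    by_cases hq₀ : q ∈ G₀.verts
    · exact Or.inr hq₀
    · exact Or.inl (hadjK p hp q (hX.mem_strictUpperVerts hq hq₀) hpq)

end KotzigOrder

theorem mainTheorem4 {V : Type*} [Finite V] (G : SimpleGraph V)
    (hG : KotzigOrder.IsFactorizable G)
    (G₀ : G.Subgraph) (hG₀ : G₀ ∈ KotzigOrder.factorComponents G)
    (K : (G.induce (KotzigOrder.strictUpperVerts G G₀)).ConnectedComponent) :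
    ∃ T ∈ KotzigOrder.canonicalPartition G G₀,
      KotzigOrder.neighbours G (Subtype.val '' K.supp) ∩ G₀.verts ⊆ T := by
  rcases (KotzigOrder.neighbours G (Subtype.val '' K.supp) ∩ G₀.verts).eq_empty_or_nonempty
    with hempty | ⟨u, hu⟩
  -- Any class will do here; one exists because a factor-component is nonempty.
  · obtain ⟨C, rfl⟩ := id hG₀
    obtain ⟨u, hu⟩ := C.nonempty_supp
    exact ⟨_, ⟨u, hu, rfl⟩, hempty ▸ Set.empty_subset _⟩
  · exact ⟨_, ⟨u, hu.2, rfl⟩,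
      fun v hv => ⟨hv.2, KotzigOrder.kotzigRel_of_mem_neighbours hG hG₀ K hu hv⟩⟩
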